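/- Let $m \ge 1$ and let $X$ be a real Banach space. Equip $\mathbb{R}^m$ with the maximum norm, let $B(t,r)$ be the open ball with centre $t$ and radius $r$, and let $|A|$ be the Lebesgue measure of $A$ and $A^o$ its interior. An *interval* is a set $\prod_{j=1}^m [a_j,b_j]$ with $-\infty<a_j<b_j<+\infty$ for all $j$; $\mathcal{I}$ is the family of all intervals and $\mathcal{I}_E$ the family of all intervals contained in $E\subset\mathbb{R}^m$. Intervals $I,J$ are *non-overlapping* if $I^o\cap J^o=\emptyset$. A function $F:\mathcal{I}_E\to X$ is *additive* if $F(I\cup J)=F(I)+F(J)$ for all non-overlapping $I,J\in\mathcal{I}_E$ with $I\cup J\in\mathcal{I}_E$. A *partition in* $E$ is a finite collection $\pi$ of pairs $(t,I)$ with $t\in E$, $I\in\mathcal{I}_E$, whose intervals are pairwise non-overlapping (it is not required that $t\in I$); it is a partition *of* $E$ if the union of its intervals is $E$, and it is $Z$-tagged if all its tags $t$ lie in $Z$. A *gauge* on $Z$ is a function $\delta:Z\to(0,+\infty)$; $\pi$ is $\delta$-fine if $I\subset B(t,\delta(t))$ for all $(t,I)\in\pi$. For an interval $W$, a function $g:W\to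 X$ is *McShane integrable* on $W$ with integral $x\in X$ if for every $\varepsilon>0$ there is a gauge $\delta$ on $W$ such that $\|\sum_{(t,I)\in\pi}g(t)|I|-x\|<\varepsilon$ for every $\delta$-fine partition $\pi$ of $W$. It is McShane integrable on $W$ with the *primitive* $\Phi:\mathcal{I}_W\to X$ if it is McShane integrable on $W$ and, for each $J\in\mathcal{I}_W$, the function $g\cdot\mathbb{1}_J$ is McShane integrable on $W$ with integral $\Phi(J)$. A *division in* $E$ is a sequence $(I_k)_{k\in\mathbb{N}}$ of pairwise non-overlapping intervals in $\mathcal{I}_E$; it is a *division of* $E$ if moreover $\bigcup_k I_k=E$. Let $E\subset\mathbb{R}^m$ be bounded and Lebesgue measurable with $E^o\ne\emptyset$, and let $F:\mathcal{I}_E\to X$ be additive. * $F$ is a *Dunford-function* if, for each division $(I_k)$ in $E$ and each $I\in\mathcal{I}$, the series $\sum_{k:|I\cap I_k|>0}F(I\cap I_k)$ is unconditionally convergent in $X$, and if its sum is $F(I)$ whenever $(I_k)$ is a division of $E^o$ and $I\in\mathcal{I}_E$. * $F$ has *$\mathcal{M}$-negligible variation outside of $E^o$* if for each $\varepsilon>0$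 there is a gauge $\delta$ on $\mathbb{R}^m\setminus E^o$ such that for each $(\mathbb{R}^m\setminus E^o)$-tagged $\delta$-fine partition $\pi$ in $\mathbb{R}^m$ and each division $(I_k)$ of $E^o$, the series $\sum_{k:|I\cap I_k|>0}F(I\cap I_k)$ is unconditionally convergent for each $(t,I)\in\pi$, and $$\Big\|\sum_{(t,I)\in\pi}\Big(\sum_{k:|I\cap I_k|>0}F(I\cap I_k)\Big)\Big\|<\varepsilon.$$ * A function $f:E\to X$ is *Dunford–McShane integrable on $E$ with the primitive $F$* if $F$ is a Dunford-function with $\mathcal{M}$-negligible variation outside of $E^o$, and for each $\varepsilon>0$ there is a gauge $\delta$ on $E^o$ such that $\|\sum_{(t,I)\in\pi}(f(t)|I|-F(I))\|<\varepsilon$ for each $\delta$-fine partition $\pi$ in $E^o$. **Theorem 2.1.** Let $G\subset\mathbb{R}^m$ be a bounded set with $G^o\neq\emptyset$ and $|G\setminus G^o|=0$, and let $I_0\in\mathcal{I}$ with $G\subset I_0$. Let $f:G\to X$ be a function and let $F:\mathcal{I}_G\to X$ be an additive interval function. Let $f_0:I_0\to X$ be equal to $f$ on $G$ and to $0$ on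 $I_0\setminus G$. Then the following statements are equivalent: (i) $f$ is Dunford–McShane integrable on $G$ with the primitive $F$; (ii) $f_0$ is McShane integrable on $I_0$ with a primitive $F_0$ such that $F_0(I)=F(I)$ for all $I\in\mathcal{I}_G$; (iii) $F$ is a Dunford-function and has $\mathcal{M}$-negligible variation outside of $G^o$, and for every division $(C_k)$ of $G^o$ and every $k$, the restriction $f|_{C_k}$ is McShane integrable on $C_k$ with the primitive $F|_{\mathcal{I}_{C_k}}$. -/

import Mathlib

open MeasureTheory BoxIntegral
open scoped Topology

noncomputable section

namespace DunfordMcShane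

/-- The family of all closed non-degenerate intervals contained in `E ⊆ ℝ^m`.  Mathlib's type
`BoxIntegral.Box (Fin m)` parametrizes the non-degenerate intervals by their corners, and
`BoxIntegral.Box.Icc` is the closed interval with these corners.  The space `Fin m → ℝ` carries
the maximum norm. -/
def Subinterval {m : ℕ} (E : Set (Fin m → ℝ)) : Type :=
  {I : Box (Fin m) // Box.Icc I ⊆ E}

namespace Subinterval

variable {m : ℕ} {A E : Set (Fin m → ℝ)}

/-- The underlying closed interval, as a set of points. -/
def toSet (I : Subinterval E) : Set (Fin m → ℝ) := Box.Icc I.1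

/-- A subinterval of `A` is a subinterval of every larger set. -/
def incl (h : A ⊆ E) (I : Subinterval A) : Subinterval E := ⟨I.1, I.2.trans h⟩

end Subinterval

/-- Two closed intervals are non-overlapping if their interiors are disjoint. -/
def NonOverlapping {m : ℕ} (I J : Box (Fin m)) : Prop :=
  Disjoint (interior (Box.Icc I)) (interior (Box.Icc J))

/-- If `|I ∩ J| > 0` then `I ∩ J` is again a non-degenerate interval. -/
theorem lower_lt_upper_of_volume_pos {m : ℕ} (I J : Box (Fin m))
    (h : 0 < volume (Box.Icc I ∩ Box.Icc J)) (i : Fin m) :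
    (I.lower ⊔ J.lower) i < (I.upper ⊓ J.upper) i := by
  by_contra hi
  rw [Box.Icc_def, Box.Icc_def, Set.Icc_inter_Icc, Real.volume_Icc_pi] at h
  refine h.ne' (Finset.prod_eq_zero (Finset.mem_univ i) ?_)
  exact ENNReal.ofReal_eq_zero.2 (by linarith [not_lt.1 hi])

/-- The interval `I ∩ J`, for intervals with `|I ∩ J| > 0`. -/
def interBox {m : ℕ} (I J : Box (Fin m)) (h : 0 < volume (Box.Icc I ∩ Box.Icc J)) :
    Box (Fin m) :=
  ⟨I.lower ⊔ J.lower, I.upper ⊓ J.upper, lower_lt_upper_of_volume_pos I J h⟩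

theorem Icc_interBox {m : ℕ} (I J : Box (Fin m)) (h : 0 < volume (Box.Icc I ∩ Box.Icc J)) :
    Box.Icc (interBox I J h) = Box.Icc I ∩ Box.Icc J := by
  simp only [Box.Icc_def, interBox, Set.Icc_inter_Icc]

section IntervalFunctions

variable {m : ℕ} {E : Set (Fin m → ℝ)} {X : Type*} [NormedAddCommGroup X]

/-- Additivity of an interval function on the subintervals of `E`. -/
def IsAdditive (F : Subinterval E → X) : Prop :=
  ∀ I J K : Subinterval E, NonOverlapping I.1 J.1 → K.toSet = I.toSet ∪ J.toSet →
    F K = F I + F J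

/-- A division in `E`: a sequence of pairwise non-overlapping subintervals of `E`. -/
def IsDivision (C : ℕ → Subinterval E) : Prop :=
  Pairwise fun j k => NonOverlapping (C j).1 (C k).1

/-- A division of `A`: a division whose union is exactly `A`. -/
def IsDivisionOf (A : Set (Fin m → ℝ)) (C : ℕ → Subinterval E) : Prop :=
  IsDivision C ∧ ⋃ k, (C k).toSet = A

open scoped Classical in
/-- `F (I ∩ J)` if `|I ∩ J| > 0`, and `0` otherwise.  Thus the series of `interTerm F I (C k)`
over all `k` is the series of `F (I ∩ C k)` over those `k` for which `|I ∩ C k| > 0`. -/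
def interTerm (F : Subinterval E → X) (I : Box (Fin m)) (J : Subinterval E) : X :=
  if h : 0 < volume (Box.Icc I ∩ Box.Icc J.1) then
    F ⟨interBox I J.1 h, (Icc_interBox I J.1 h).trans_subset (Set.inter_subset_right.trans J.2)⟩
  else 0

/-- Dunford-functions.  `Summable` and `HasSum` are unconditional convergence. -/
structure IsDunfordFunction (F : Subinterval E → X) : Prop where
  additive : IsAdditive F
  summable : ∀ C : ℕ → Subinterval E, IsDivision C →
    ∀ I : Box (Fin m), Summable fun k => interTerm F I (C k)
  hasSum : ∀ C : ℕ → Subinterval E, IsDivisionOf (interior E) C →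
    ∀ I : Subinterval E, HasSum (fun k => interTerm F I.1 (C k)) (F I)

/-- A McShane partition in `E`: a finite collection of pairs of a tag in `E` and a subinterval
of `E`, the intervals being pairwise non-overlapping.  The tag need not lie in its interval. -/
def IsPartition (π : Finset (E × Subinterval E)) : Prop :=
  (π : Set (E × Subinterval E)).Pairwise fun p q => NonOverlapping p.2.1 q.2.1

/-- Every interval lies in the open ball around its tag whose radius is the value of the gauge. -/
def IsFine (δ : (Fin m → ℝ) → ℝ) (π : Finset (E × Subinterval E)) : Prop :=
  ∀ p ∈ π, p.2.toSet ⊆ Metric.ball (p.1 : Fin m → ℝ) (δ p.1)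

/-- `δ` is a gauge on `Z` (its values off `Z` play no role). -/
def IsGaugeOn (Z : Set (Fin m → ℝ)) (δ : (Fin m → ℝ) → ℝ) : Prop :=
  ∀ t ∈ Z, 0 < δ t

/-- `F` has McShane-negligible variation over `Z`; the partitions are in the whole of `ℝ^m`. -/
def HasNegligibleVariationOver (F : Subinterval E → X) (Z : Set (Fin m → ℝ)) : Prop :=
  ∀ ε : ℝ, 0 < ε → ∃ δ : (Fin m → ℝ) → ℝ, IsGaugeOn Z δ ∧
    ∀ π : Finset (↥(Set.univ : Set (Fin m → ℝ)) × Subinterval (Set.univ : Set (Fin m → ℝ))),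
      IsPartition π → (∀ p ∈ π, (p.1 : Fin m → ℝ) ∈ Z) → IsFine δ π →
      ∀ C : ℕ → Subinterval E, IsDivisionOf (interior E) C →
        (∀ p ∈ π, Summable fun k => interTerm F p.2.1 (C k)) ∧
        ‖∑ p ∈ π, ∑' k, interTerm F p.2.1 (C k)‖ < ε

/-- `F` has McShane-negligible variation outside of the interior of `E`. -/
def HasNegligibleVariationOutside (F : Subinterval E → X) : Prop :=
  HasNegligibleVariationOver F (interior E)ᶜ

/-- The extension by zero of a function given on a set. -/
def zeroExt (f : E → X) (t : Fin m → ℝ) : X :=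
  open scoped Classical in if h : t ∈ E then f ⟨t, h⟩ else 0

end IntervalFunctions

section Integrals

variable {m : ℕ} {E : Set (Fin m → ℝ)} {X : Type*} [NormedAddCommGroup X] [NormedSpace ℝ X]

/-- `f` is McShane integrable on the closed interval `W` with the primitive `Φ`: `f` is McShane
integrable on `W`, and for each subinterval `J` of `W` the McShane integral on `W` of the product
of `f` and the characteristic function of `J` is `Φ J`.
(Mathlib's integral on a box evaluates its integrand only at points of the closed box.) -/
def McShaneIntegrableWithPrimitive (W : Box (Fin m)) (f : Box.Icc W → X)
    (Φ : Subinterval (Box.Icc W) → X) : Prop :=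
  BoxIntegral.Integrable W IntegrationParams.McShane (zeroExt f) BoxAdditiveMap.volume ∧
  ∀ J : Subinterval (Box.Icc W),
    BoxIntegral.HasIntegral W IntegrationParams.McShane (J.toSet.indicator (zeroExt f))
      BoxAdditiveMap.volume (Φ J)

/-- `f` is Dunford-McShane integrable on `E` with the primitive `F`. -/
structure DunfordMcShaneIntegrableWithPrimitive (f : E → X) (F : Subinterval E → X) :
    Prop where
  approx : ∀ ε : ℝ, 0 < ε → ∃ δ : (Fin m → ℝ) → ℝ, IsGaugeOn (interior E) δ ∧
    ∀ π : Finset (interior E × Subinterval (interior E)), IsPartition π → IsFine δ π →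
      ‖∑ p ∈ π, (volume.real p.2.toSet • f (Set.inclusion interior_subset p.1) -
        F (p.2.incl interior_subset))‖ < ε
  dunford : IsDunfordFunction F
  negligible : HasNegligibleVariationOutside F

end Integrals

end DunfordMcShane

end

open DunfordMcShane

noncomputable section

namespace DunfordMcShane

/-! ### Half-open boxes as models of closed intervals -/

section Boxes

variable {m : ℕ}

/-! The engine is Henstock's lemma (`McShaneIntegrable.exists_gauge`) together with absolute
continuity of the indefinite integral (`McShaneIntegrable.exists_norm_sum_le`). Since `G` differs
from its interior by a null set, the integrand may be taken to vanish off the interior, so tags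
there contribute no Riemann term.

(i) to (ii): a box with an interior tag is forced into the interior, where the approximation
condition applies; the other boxes contribute only series of `F`, made small by negligible
variation. The integral over a box `J` is thus the series of `F` over the pieces `J ∩ C k`, and for
`J` inside `G` the Dunford property turns it into `F J`.

(ii) to (iii): absolute continuity turns convergence of the volumes of a division into unconditional
convergence of the integrals, with the correct sum. Negligible variation is Henstock's lemma for the
pieces `I ∩ C k`, whose Riemann terms vanish.

(iii) to (i): one locally finite division of the interior, into maximal dyadic cubes, suffices. Near
each point only finitely many cubes matter, so a single gauge can respect the Henstock gauges of all
cubes, with errors summing geometrically. -/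

/-- The extension of a function of boxes by zero to the empty box. -/
def extendBot {M : Type*} [Zero M] (φ : Box (Fin m) → M) : WithBot (Box (Fin m)) → M :=
  Option.elim' 0 φ

@[simp]
theorem extendBot_bot {M : Type*} [Zero M] (φ : Box (Fin m) → M) : extendBot φ ⊥ = 0 := rfl

@[simp]
theorem extendBot_coe {M : Type*} [Zero M] (φ : Box (Fin m) → M) (J : Box (Fin m)) :
    extendBot φ (J : WithBot (Box (Fin m))) = φ J := rfl

theorem extendBot_congr {M : Type*} [Zero M] {φ ψ : Box (Fin m) → M} {B : WithBot (Box (Fin m))}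
    (h : ∀ J : Box (Fin m), B = J → φ J = ψ J) : extendBot φ B = extendBot ψ B := by
  induction B with
  | bot => rfl
  | coe J => exact h J rfl

theorem extendBot_sub {M : Type*} [AddGroup M] (φ ψ : Box (Fin m) → M)
    (B : WithBot (Box (Fin m))) :
    extendBot (fun J => φ J - ψ J) B = extendBot φ B - extendBot ψ B := by
  induction B with
  | bot => simp
  | coe J => rfl

theorem interior_Icc (I : Box (Fin m)) : interior (Box.Icc I) = Box.Ioo I := by
  rw [Box.Icc_eq_pi, interior_pi_set Set.finite_univ]
  exact Set.pi_congr rfl fun i _ => _root_.interior_Icc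

theorem inf_coe (I J : Box (Fin m)) : (I : WithBot (Box (Fin m))) ⊓ J =
    Box.mk' (I.lower ⊔ J.lower) (I.upper ⊓ J.upper) := rfl

theorem inf_ne_bot_iff (I J : Box (Fin m)) : (I : WithBot (Box (Fin m))) ⊓ J ≠ ⊥ ↔
    ∀ i, (I.lower ⊔ J.lower) i < (I.upper ⊓ J.upper) i := by
  rw [inf_coe, Ne, Box.mk'_eq_bot]
  push Not
  rfl

theorem Icc_of_inf_eq {I J K : Box (Fin m)} (h : (I : WithBot (Box (Fin m))) ⊓ J = K) :
    Box.Icc K = Box.Icc I ∩ Box.Icc J := by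
  rw [inf_coe, Box.mk'_eq_coe] at h
  rw [Box.Icc_def, Box.Icc_def, Box.Icc_def, Set.Icc_inter_Icc, h.1, h.2]

theorem coe_of_inf_eq {I J K : Box (Fin m)} (h : (I : WithBot (Box (Fin m))) ⊓ J = K) :
    (K : Set (Fin m → ℝ)) = (I : Set (Fin m → ℝ)) ∩ J := by
  have := Box.coe_inf (I : WithBot (Box (Fin m))) J
  rwa [h] at this

theorem inf_eq_coe_of_le {I J : Box (Fin m)} (h : I ≤ J) :
    (I : WithBot (Box (Fin m))) ⊓ J = I :=
  inf_eq_left.2 (WithBot.coe_le_coe.2 h)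

/-- Closed intervals sharing only a face come from disjoint half-open boxes, so lattice disjointness
is the right notion. If the meet is nonempty, its midpoint lies in both interiors. -/
theorem nonOverlapping_iff {I J : Box (Fin m)} :
    NonOverlapping I J ↔ Disjoint (I : WithBot (Box (Fin m))) J := by
  rw [NonOverlapping, interior_Icc, interior_Icc, Set.disjoint_iff_inter_eq_empty, disjoint_iff,
    ← not_iff_not, ← Ne, ← Ne, ← Set.nonempty_iff_ne_empty, inf_ne_bot_iff]
  constructor
  · rintro ⟨x, hI, hJ⟩ i
    have h1 := hI i trivial
    have h2 := hJ i trivial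
    exact (max_lt h1.1 h2.1).trans (lt_min h1.2 h2.2)
  · intro h
    refine ⟨fun i => ((I.lower ⊔ J.lower) i + (I.upper ⊓ J.upper) i) / 2, fun i _ => ?_,
      fun i _ => ?_⟩ <;>
    · have hi := h i
      have h1 : I.lower i ≤ (I.lower ⊔ J.lower) i := le_sup_left
      have h2 : J.lower i ≤ (I.lower ⊔ J.lower) i := le_sup_right
      have h3 : (I.upper ⊓ J.upper) i ≤ I.upper i := inf_le_left
      have h4 : (I.upper ⊓ J.upper) i ≤ J.upper i := inf_le_right
      constructor <;> linarith

theorem volume_inter_pos_iff (I J : Box (Fin m)) :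
    0 < volume (Box.Icc I ∩ Box.Icc J) ↔ (I : WithBot (Box (Fin m))) ⊓ J ≠ ⊥ := by
  rw [inf_ne_bot_iff]
  refine ⟨lower_lt_upper_of_volume_pos I J, fun h => ?_⟩
  rw [Box.Icc_def, Box.Icc_def, Set.Icc_inter_Icc, Real.volume_Icc_pi, pos_iff_ne_zero,
    Finset.prod_ne_zero_iff]
  intro i _
  exact (ENNReal.ofReal_pos.2 (sub_pos.2 (h i))).ne'

theorem volume_real_Icc (I : Box (Fin m)) :
    volume.real (Box.Icc I) = volume.real (I : Set (Fin m → ℝ)) :=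
  (measureReal_congr I.coe_ae_eq_Icc).symm

theorem volume_smul_eq {X : Type*} [NormedAddCommGroup X] [NormedSpace ℝ X] (I : Box (Fin m))
    (x : X) : BoxAdditiveMap.volume I x = volume.real (I : Set (Fin m → ℝ)) • x := rfl

open scoped Classical in
/-- The prepartition formed by the nonempty members of a finite disjoint family of boxes. -/
def familyPrepartition {κ : Type*} (W : Box (Fin m)) (s : Finset κ)
    (B : κ → WithBot (Box (Fin m))) (hle : ∀ i ∈ s, B i ≤ W)
    (hd : (s : Set κ).Pairwise fun i j => Disjoint (B i) (B j)) : Prepartition W :=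
  Prepartition.ofWithBot (s.image B)
    (by
      intro J hJ
      obtain ⟨i, hi, rfl⟩ := Finset.mem_image.1 hJ
      exact hle i hi)
    (show Set.Pairwise _ _ by
      intro J hJ K hK hne
      obtain ⟨i, hi, rfl⟩ := Finset.mem_image.1 (Finset.mem_coe.1 hJ)
      obtain ⟨j, hj, rfl⟩ := Finset.mem_image.1 (Finset.mem_coe.1 hK)
      exact hd hi hj (fun h => hne (by rw [h])))

section family

variable {κ : Type*} {W : Box (Fin m)} {s : Finset κ} {B : κ → WithBot (Box (Fin m))}
  {hle : ∀ i ∈ s, B i ≤ W} {hd : (s : Set κ).Pairwise fun i j => Disjoint (B i) (B j)}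

theorem mem_familyPrepartition {J : Box (Fin m)} :
    J ∈ familyPrepartition W s B hle hd ↔ ∃ i ∈ s, B i = J := by
  classical
  rw [familyPrepartition, Prepartition.mem_ofWithBot, Finset.mem_image]

theorem sum_familyPrepartition {M : Type*} [AddCommMonoid M] (φ : Box (Fin m) → M) :
    ∑ J ∈ (familyPrepartition W s B hle hd).boxes, φ J = ∑ i ∈ s, extendBot φ (B i) := by
  classical
  rw [familyPrepartition, Prepartition.sum_ofWithBot]
  exact Finset.sum_image_of_disjoint rfl hd

theorem iUnion_familyPrepartition :
    (familyPrepartition W s B hle hd).iUnion = ⋃ i ∈ s, (B i : Set (Fin m → ℝ)) := by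
  classical
  rw [familyPrepartition, Prepartition.iUnion_ofWithBot]
  simp

end family

end Boxes

/-! ### Interval functions as functions of boxes -/

section IntervalFunctions

variable {m : ℕ} {E : Set (Fin m → ℝ)} {X : Type*} [NormedAddCommGroup X]

open scoped Classical in
/-- An interval function on the subintervals of `E`, as a function of all boxes. -/
def boxFun (F : Subinterval E → X) (J : Box (Fin m)) : X :=
  if h : Box.Icc J ⊆ E then F ⟨J, h⟩ else 0

theorem boxFun_of_subset (F : Subinterval E → X) {J : Box (Fin m)} (h : Box.Icc J ⊆ E) :
    boxFun F J = F ⟨J, h⟩ := dif_pos h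

/-- Lets every series over a division be treated as a sum over meets of boxes, the empty box
contributing zero. -/
theorem interTerm_eq (F : Subinterval E → X) (I : Box (Fin m)) (J : Subinterval E) :
    interTerm F I J = extendBot (boxFun F) ((I : WithBot (Box (Fin m))) ⊓ J.1) := by
  by_cases h : 0 < volume (Box.Icc I ∩ Box.Icc J.1)
  · have h' : (I : WithBot (Box (Fin m))) ⊓ J.1 = interBox I J.1 h := by
      rw [inf_coe, Box.mk'_eq_coe]
      exact ⟨rfl, rfl⟩
    rw [interTerm, dif_pos h, h', extendBot_coe, boxFun_of_subset]
  · rw [interTerm, dif_neg h, not_not.1 (mt (volume_inter_pos_iff I J.1).2 h), extendBot_bot]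

/-- An additive interval function is box-additive on each subinterval. -/
def IsAdditive.toBoxAdditive {F : Subinterval E → X} (hF : IsAdditive F) (W : Subinterval E) :
    Fin m →ᵇᵃ[W.1] X :=
  BoxAdditiveMap.ofMapSplitAdd (boxFun F) W.1 (by
    intro I hI i x hx
    have hI' : Box.Icc I ⊆ E := (Box.le_iff_Icc.1 (WithTop.coe_le_coe.1 hI)).trans W.2
    rw [Box.splitLower_def hx, Box.splitUpper_def hx]
    change boxFun F _ + boxFun F _ = boxFun F I
    generalize_proofs h₁ h₂
    have hU : Box.Icc I = Box.Icc (⟨I.lower, Function.update I.upper i x, h₁⟩ : Box (Fin m)) ∪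
        Box.Icc (⟨Function.update I.lower i x, I.upper, h₂⟩ : Box (Fin m)) := by
      ext y
      simp only [Box.Icc_def, Set.mem_union, Set.mem_Icc, le_update_iff, update_le_iff]
      constructor
      · rintro ⟨hl, hu⟩
        rcases le_total (y i) x with h | h
        · exact Or.inl ⟨hl, h, fun j _ => hu j⟩
        · exact Or.inr ⟨⟨h, fun j _ => hl j⟩, hu⟩
      · rintro (⟨hl, h, hu⟩ | ⟨⟨h, hl⟩, hu⟩)
        · refine ⟨hl, fun j => ?_⟩
          by_cases hj : j = i
          · subst hj; exact h.trans hx.2.le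
          · exact hu j hj
        · refine ⟨fun j => ?_, hu⟩
          by_cases hj : j = i
          · subst hj; exact hx.1.le.trans h
          · exact hl j hj
    have hL := Set.subset_union_left.trans (hU.symm.subset.trans hI')
    have hR := Set.subset_union_right.trans (hU.symm.subset.trans hI')
    rw [boxFun_of_subset F hI', boxFun_of_subset F hL, boxFun_of_subset F hR]
    refine (hF ⟨_, hL⟩ ⟨_, hR⟩ ⟨I, hI'⟩ (nonOverlapping_iff.2 ?_) hU).symm
    rw [← Box.splitLower_def hx, ← Box.splitUpper_def hx]
    exact Box.disjoint_splitLower_splitUpper I i x)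

@[simp]
theorem IsAdditive.toBoxAdditive_apply {F : Subinterval E → X} (hF : IsAdditive F)
    (W : Subinterval E) (J : Box (Fin m)) : hF.toBoxAdditive W J = boxFun F J := rfl

end IntervalFunctions

/-! ### McShane integral: Henstock's lemma, absolute continuity, subintervals -/

section McShane

variable {m : ℕ} {X : Type*} [NormedAddCommGroup X] [NormedSpace ℝ X] {W J : Box (Fin m)}
  {g h : (Fin m → ℝ) → X} {y : X}

/-- `y` is the McShane integral of `g` on `W`. -/
abbrev HasMcShaneIntegral (W : Box (Fin m)) (g : (Fin m → ℝ) → X) (y : X) : Prop :=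
  HasIntegral W IntegrationParams.McShane g BoxAdditiveMap.volume y

/-- McShane integrability on a box. -/
abbrev McShaneIntegrable (W : Box (Fin m)) (g : (Fin m → ℝ) → X) : Prop :=
  BoxIntegral.Integrable W IntegrationParams.McShane g BoxAdditiveMap.volume

/-- The McShane integral on a box. -/
abbrev mcShaneIntegral (g : (Fin m → ℝ) → X) (W : Box (Fin m)) : X :=
  BoxIntegral.integral W IntegrationParams.McShane g BoxAdditiveMap.volume

theorem memBaseSet_mcShane {c : NNReal} {r : (Fin m → ℝ) → Set.Ioi (0 : ℝ)}
    {π : TaggedPrepartition W} (hπ : π.IsSubordinate r) :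
    IntegrationParams.McShane.MemBaseSet W c r π :=
  ⟨hπ, nofun, nofun, nofun⟩

theorem hasMcShaneIntegral_of_forall
    (H : ∀ ε : ℝ, 0 < ε → ∃ δ : (Fin m → ℝ) → ℝ, (∀ t, 0 < δ t) ∧ ∀ π : TaggedPrepartition W,
      (∀ J ∈ π, Box.Icc J ⊆ Metric.closedBall (π.tag J) (δ (π.tag J))) → π.IsPartition →
        ‖∑ J ∈ π.boxes, volume.real (J : Set (Fin m → ℝ)) • g (π.tag J) - y‖ ≤ ε) :
    HasMcShaneIntegral W g y := by
  refine hasIntegral_iff.2 fun ε hε => ?_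
  obtain ⟨δ, hδ, hH⟩ := H ε hε
  refine ⟨fun _ t => ⟨δ t, hδ t⟩, fun c => nofun, fun c π hπ hp => ?_⟩
  rw [dist_eq_norm]
  exact hH π hπ.isSubordinate hp

theorem McShaneIntegrable.congr_ae (hg : McShaneIntegrable W g)
    (hgh : g =ᵐ[volume.restrict (W : Set (Fin m → ℝ))] h) : McShaneIntegrable W h :=
  (HasIntegral.congr_ae hg.hasIntegral hgh rfl).integrable

theorem mcShaneIntegral_congr_ae (hg : McShaneIntegrable W g)
    (hgh : g =ᵐ[volume.restrict (W : Set (Fin m → ℝ))] h) :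
    mcShaneIntegral h W = mcShaneIntegral g W :=
  (HasIntegral.congr_ae hg.hasIntegral hgh rfl).integral_eq

theorem McShaneIntegrable.congr (hg : McShaneIntegrable W g) (hgh : Set.EqOn g h (Box.Icc W)) :
    McShaneIntegrable W h :=
  ((hasIntegral_congr W _ hgh (fun _ _ => rfl) _).1 hg.hasIntegral).integrable

theorem mcShaneIntegral_congr (hg : McShaneIntegrable W g) (hgh : Set.EqOn g h (Box.Icc W)) :
    mcShaneIntegral h W = mcShaneIntegral g W :=
  ((hasIntegral_congr W _ hgh (fun _ _ => rfl) _).1 hg.hasIntegral).integral_eq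

/-- The sum of a box-additive function over a finite disjoint family covering a box. -/
theorem sum_extendBot_of_iUnion_eq {M κ : Type*} [AddCommMonoid M] (Φ : Fin m →ᵇᵃ[W] M)
    {s : Finset κ} {B : κ → WithBot (Box (Fin m))} (hle : ∀ i ∈ s, B i ≤ W)
    (hd : (s : Set κ).Pairwise fun i j => Disjoint (B i) (B j))
    (hU : ⋃ i ∈ s, (B i : Set (Fin m → ℝ)) = W) :
    ∑ i ∈ s, extendBot Φ (B i) = Φ W := by
  rw [← sum_familyPrepartition (hle := hle) (hd := hd)]
  refine Φ.sum_partition_boxes le_rfl (Prepartition.isPartition_iff_iUnion_eq.2 ?_)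
  rw [iUnion_familyPrepartition, hU]

theorem sum_extendBot_inf {M : Type*} [AddCommMonoid M] (Φ : Fin m →ᵇᵃ[J] M) (hJ : J ≤ W)
    {π : Prepartition W} (hπ : π.IsPartition) :
    ∑ K ∈ π.boxes, extendBot Φ ((K : WithBot (Box (Fin m))) ⊓ J) = Φ J := by
  refine sum_extendBot_of_iUnion_eq Φ (fun _ _ => inf_le_right) (fun K hK L hL hne => ?_) ?_
  · exact (Box.disjoint_coe.2 (π.disjoint_coe_of_mem hK hL hne)).mono inf_le_left inf_le_left
  · simp only [Box.coe_inf, ← Set.iUnion_inter]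
    change (⋃ K ∈ π.boxes, (K : Set (Fin m → ℝ))) ∩ (J : Set (Fin m → ℝ)) = _
    rw [← Prepartition.iUnion_def', hπ.iUnion_eq]
    exact Set.inter_eq_right.2 hJ

variable [CompleteSpace X]

/-- **Henstock's lemma** for finite disjoint families of tagged boxes, some possibly empty. -/
theorem McShaneIntegrable.exists_gauge (hg : McShaneIntegrable W g) {ε : ℝ} (hε : 0 < ε) :
    ∃ δ : (Fin m → ℝ) → ℝ, (∀ t, 0 < δ t) ∧
      ∀ {κ : Type} (s : Finset κ) (B : κ → WithBot (Box (Fin m))) (t : κ → Fin m → ℝ),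
        (∀ i ∈ s, B i ≤ W) → ((s : Set κ).Pairwise fun i j => Disjoint (B i) (B j)) →
        (∀ i ∈ s, ∀ J : Box (Fin m), B i = J →
          t i ∈ Box.Icc W ∧ Box.Icc J ⊆ Metric.closedBall (t i) (δ (t i))) →
        ‖∑ i ∈ s, extendBot (fun J => volume.real (J : Set (Fin m → ℝ)) • g (t i) -
          mcShaneIntegral g J) (B i)‖ ≤ ε := by
  classical
  refine ⟨fun t => hg.convergenceR ε 0 t, fun t => (hg.convergenceR ε 0 t).2, ?_⟩
  intro κ s B t hle hd hfine
  -- By disjointness a nonempty box occurs for at most one index, so tags pass from indices to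
  -- boxes; other boxes get a dummy corner.
  have hex : ∀ J : Box (Fin m), ∃ x ∈ Box.Icc W, ∀ i ∈ s, B i = J → x = t i := by
    intro J
    by_cases hJ : ∃ i ∈ s, B i = J
    · obtain ⟨i, hi, hiJ⟩ := hJ
      refine ⟨t i, (hfine i hi J hiJ).1, fun j hj hjJ => ?_⟩
      by_contra hne
      have := hd hi hj (fun h => hne (by rw [h]))
      simp only [hiJ, hjJ, disjoint_self] at this
      exact WithBot.coe_ne_bot this
    · exact ⟨_, W.upper_mem_Icc, fun i hi hiJ => (hJ ⟨i, hi, hiJ⟩).elim⟩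
  choose tag htag htag' using hex
  let π : TaggedPrepartition W := ⟨familyPrepartition W s B hle hd, tag, htag⟩
  have hπ : IntegrationParams.McShane.MemBaseSet W 0 (hg.convergenceR ε 0) π := by
    refine memBaseSet_mcShane fun J hJ => ?_
    obtain ⟨i, hi, hiJ⟩ := (mem_familyPrepartition (hle := hle) (hd := hd)).1 hJ
    change Box.Icc J ⊆ Metric.closedBall (tag J) (hg.convergenceR ε 0 (tag J))
    rw [htag' J i hi hiJ]
    exact (hfine i hi J hiJ).2
  have := hg.dist_integralSum_sum_integral_le_of_memBaseSet hε hπ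
  rw [dist_eq_norm, integralSum, ← Finset.sum_sub_distrib] at this
  refine le_trans (le_of_eq (congrArg _ ?_)) this
  refine Eq.trans ?_ (sum_familyPrepartition (hle := hle) (hd := hd) _).symm
  refine Finset.sum_congr rfl fun i hi => extendBot_congr fun J hJ => ?_
  change _ = volume.real (J : Set (Fin m → ℝ)) • g (tag J) - _
  rw [htag' J i hi hJ]

/-- Absolute continuity of the indefinite McShane integral. -/
theorem McShaneIntegrable.exists_norm_sum_le (hg : McShaneIntegrable W g) {ε : ℝ} (hε : 0 < ε) :
    ∃ η : ℝ, 0 < η ∧ ∀ π : Prepartition W, volume.real π.iUnion < η →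
      ‖∑ J ∈ π.boxes, mcShaneIntegral g J‖ ≤ ε := by
  -- A single fine partition has finitely many tags, so `g` is bounded by `M` on them. Cutting it by
  -- `π` keeps the tags, which need not lie in their boxes, so the Riemann sum is at most `M` times
  -- the measure.
  obtain ⟨π₀, hπ₀, hp⟩ := IntegrationParams.McShane.exists_memBaseSet_isPartition W le_rfl
    (hg.convergenceR (ε / 2) W.distortion)
  set M : ℝ := ∑ J ∈ π₀.boxes, ‖g (π₀.tag J)‖ with hM
  have hM0 : 0 ≤ M := Finset.sum_nonneg fun _ _ => norm_nonneg _
  refine ⟨ε / 2 / (M + 1), by positivity, fun π hπ => ?_⟩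
  have hπ' : IntegrationParams.McShane.MemBaseSet W W.distortion
      (hg.convergenceR (ε / 2) W.distortion) (π₀.infPrepartition π) :=
    memBaseSet_mcShane (hπ₀.isSubordinate.infPrepartition π)
  have hU : (π₀.infPrepartition π).iUnion = π.iUnion := by
    change (π₀.toPrepartition ⊓ π).iUnion = _
    rw [Prepartition.iUnion_inf]
    exact Set.inter_eq_right.2 (π.iUnion_subset.trans hp.iUnion_eq.symm.subset)
  have h1 := hg.dist_integralSum_sum_integral_le_of_memBaseSet_of_iUnion_eq (half_pos hε) hπ' hU
  have h2 : ‖integralSum g BoxAdditiveMap.volume (π₀.infPrepartition π)‖ ≤ ε / 2 := by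
    calc ‖integralSum g BoxAdditiveMap.volume (π₀.infPrepartition π)‖
        ≤ ∑ J ∈ (π₀.infPrepartition π).boxes, volume.real (J : Set (Fin m → ℝ)) * M := by
          refine norm_sum_le_of_le _ fun J hJ => ?_
          rw [volume_smul_eq, norm_smul, Real.norm_of_nonneg measureReal_nonneg]
          refine mul_le_mul_of_nonneg_left ?_ measureReal_nonneg
          exact Finset.single_le_sum (f := fun J => ‖g (π₀.tag J)‖) (fun _ _ => norm_nonneg _)
            (π₀.toPrepartition.biUnionIndex_mem hJ)
      _ = volume.real π.iUnion * M := by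
          rw [← Finset.sum_mul, ← Prepartition.measure_iUnion_toReal]
          exact congrArg (fun S => volume.real S * M) hU
      _ ≤ ε / 2 / (M + 1) * (M + 1) := by gcongr; linarith
      _ = ε / 2 := by field_simp
  rw [dist_eq_norm] at h1
  have h3 := norm_sub_norm_le (∑ J ∈ π.boxes, mcShaneIntegral g J)
    (integralSum g BoxAdditiveMap.volume (π₀.infPrepartition π))
  rw [norm_sub_rev] at h3
  linarith

/-- The integral over a subbox is the integral of the product with its indicator function. -/
theorem hasMcShaneIntegral_indicator_Icc (hg : HasMcShaneIntegral J g y) (hJ : J ≤ W) :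
    HasMcShaneIntegral W ((Box.Icc J).indicator g) y := by
  -- Discarding the boundary, a null set, makes the integrand vanish at the tags for which no ball
  -- stays on one side of it.
  have hg' : HasMcShaneIntegral J ((Box.Ioo J).indicator g) y := by
    refine HasIntegral.congr_ae hg ?_ rfl
    rw [Measure.restrict_congr_set J.coe_ae_eq_Icc, ← Measure.restrict_congr_set J.Ioo_ae_eq_Icc]
    exact (indicator_ae_eq_restrict J.measurableSet_Ioo).symm
  have hW : HasMcShaneIntegral W ((Box.Ioo J).indicator g) y := by
    refine hasMcShaneIntegral_of_forall fun ε hε => ?_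
    obtain ⟨δ, hδ, hδ'⟩ := McShaneIntegrable.exists_gauge hg'.integrable hε
    -- Interior tags get boxes inside `J`, exterior tags get boxes missing `J`, and boundary tags
    -- need no restriction.
    have hρ : ∀ t, ∃ ρ : ℝ, 0 < ρ ∧ (t ∈ Box.Ioo J → Metric.closedBall t ρ ⊆ Box.Ioo J) ∧
        (t ∉ Box.Icc J → Metric.closedBall t ρ ⊆ (Box.Icc J)ᶜ) := by
      intro t
      by_cases h1 : t ∈ Box.Ioo J
      · have hopen : IsOpen (Box.Ioo J) := by
          rw [← interior_Icc]; exact isOpen_interior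
        obtain ⟨ρ, hρ, h⟩ := Metric.nhds_basis_closedBall.mem_iff.1 (hopen.mem_nhds h1)
        exact ⟨ρ, hρ, fun _ => h, fun h2 => (h2 (J.Ioo_subset_Icc h1)).elim⟩
      · by_cases h2 : t ∈ Box.Icc J
        · exact ⟨1, one_pos, fun h => (h1 h).elim, fun h => (h h2).elim⟩
        · have hcl : IsOpen (Box.Icc J)ᶜ := J.isCompact_Icc.isClosed.isOpen_compl
          obtain ⟨ρ, hρ, h⟩ := Metric.nhds_basis_closedBall.mem_iff.1 (hcl.mem_nhds h2)
          exact ⟨ρ, hρ, fun h => (h1 h).elim, fun _ => h⟩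
    choose ρ hρ0 hρ1 hρ2 using hρ
    refine ⟨fun t => min (δ t) (ρ t), fun t => lt_min (hδ t) (hρ0 t), fun π hπ hp => ?_⟩
    have key := hδ' π.boxes (fun K => (K : WithBot (Box (Fin m))) ⊓ J) π.tag
      (fun _ _ => inf_le_right)
      (fun K hK L hL hne => (Box.disjoint_coe.2 (π.disjoint_coe_of_mem hK hL hne)).mono
        inf_le_left inf_le_left) ?_
    · simp only [extendBot_sub, Finset.sum_sub_distrib] at key
      rw [show ∑ K ∈ π.boxes, extendBot (mcShaneIntegral ((Box.Ioo J).indicator g))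
          ((K : WithBot (Box (Fin m))) ⊓ J) = y from
        (sum_extendBot_inf hg'.integrable.toBoxAdditive hJ hp).trans hg'.integral_eq] at key
      refine le_trans (le_of_eq (congrArg (fun x => ‖x - y‖) ?_)) key
      refine Finset.sum_congr rfl fun K hK => ?_
      by_cases ht : π.tag K ∈ Box.Ioo J
      · have hKJ : K ≤ J := Box.le_iff_Icc.2 <| (hπ K hK).trans <|
          (Metric.closedBall_subset_closedBall (min_le_right _ _)).trans <|
            (hρ1 _ ht).trans J.Ioo_subset_Icc
        rw [inf_eq_coe_of_le hKJ, extendBot_coe]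
      · rw [Set.indicator_of_notMem ht, smul_zero]
        induction (K : WithBot (Box (Fin m))) ⊓ J with
        | bot => rfl
        | coe L => rw [extendBot_coe, smul_zero]
    · intro K hK L hL
      have hLK := Icc_of_inf_eq hL
      have hKb := hπ K hK
      refine ⟨?_, ?_⟩
      · by_contra ht
        have hup := L.upper_mem_Icc
        rw [hLK] at hup
        exact hρ2 _ ht (Metric.closedBall_subset_closedBall (min_le_right _ _) (hKb hup.1)) hup.2
      · rw [hLK]
        exact Set.inter_subset_left.trans (hKb.trans
          (Metric.closedBall_subset_closedBall (min_le_left _ _)))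
  refine HasIntegral.congr_ae hW (ae_restrict_of_ae ?_) rfl
  exact indicator_ae_eq_of_ae_eq_set J.Ioo_ae_eq_Icc

/-- Integrating over `W` against the indicator of `J` amounts to integrating over `J`; uniqueness of
the integral does the rest. -/
theorem mcShaneIntegrableWithPrimitive_iff {f : Box.Icc W → X}
    {Φ : Subinterval (Box.Icc W) → X} :
    McShaneIntegrableWithPrimitive W f Φ ↔ McShaneIntegrable W (zeroExt f) ∧
      ∀ J : Subinterval (Box.Icc W), mcShaneIntegral (zeroExt f) J.1 = Φ J := by
  refine and_congr_right fun hf => forall_congr' fun J => ?_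
  have hJ : J.1 ≤ W := Box.le_iff_Icc.2 J.2
  have := hasMcShaneIntegral_indicator_Icc (hf.to_subbox hJ).hasIntegral hJ
  exact ⟨fun h => this.unique h, fun h => h ▸ this⟩

end McShane

/-! ### Series over divisions -/

section Series

variable {m : ℕ} {E : Set (Fin m → ℝ)} {X : Type*} [NormedAddCommGroup X] [NormedSpace ℝ X]
  {W I : Box (Fin m)} {g : (Fin m → ℝ) → X} {C : ℕ → Subinterval E}

theorem extendBot_volume (B : WithBot (Box (Fin m))) :
    extendBot (fun J => volume.real (J : Set (Fin m → ℝ))) B =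
      volume.real (B : Set (Fin m → ℝ)) := by
  induction B with
  | bot => rw [extendBot_bot, Box.coe_bot, measureReal_empty]
  | coe J => rfl

theorem IsDivision.disjoint (hC : IsDivision C) {j k : ℕ} (hjk : j ≠ k) :
    Disjoint ((C j).1 : WithBot (Box (Fin m))) (C k).1 :=
  nonOverlapping_iff.1 (hC hjk)

theorem IsDivision.pairwise_inf (hC : IsDivision C) (B : WithBot (Box (Fin m))) (s : Set ℕ) :
    s.Pairwise fun j k => Disjoint (B ⊓ (C j).1) (B ⊓ (C k).1) :=
  fun _ _ _ _ hjk => (hC.disjoint hjk).mono inf_le_right inf_le_right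

/-- Countable additivity applies to the half-open boxes, which are truly disjoint and differ from
the closed ones by null sets. -/
theorem IsDivision.hasSum_volume (hC : IsDivision C) (I : Box (Fin m)) :
    HasSum (fun k => extendBot (fun J => volume.real (J : Set (Fin m → ℝ)))
      ((I : WithBot (Box (Fin m))) ⊓ (C k).1))
      (volume.real (Box.Icc I ∩ ⋃ k, (C k).toSet)) := by
  simp only [extendBot_volume, Box.coe_inf]
  have hset : (⋃ k, (I : Set (Fin m → ℝ)) ∩ ((C k).1 : Set (Fin m → ℝ))) =ᵐ[volume]
      (Box.Icc I ∩ ⋃ k, (C k).toSet : Set (Fin m → ℝ)) := by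
    rw [← Set.inter_iUnion]
    exact I.coe_ae_eq_Icc.inter (Filter.EventuallyEq.countable_iUnion fun k =>
      (C k).1.coe_ae_eq_Icc)
  have hmeas := measure_iUnion (μ := volume)
    (f := fun k => (I : Set (Fin m → ℝ)) ∩ ((C k).1 : Set (Fin m → ℝ)))
    (fun j k hjk => (Box.disjoint_coe.1 (hC.disjoint hjk)).mono
      Set.inter_subset_right Set.inter_subset_right)
    (fun k => I.measurableSet_coe.inter (C k).1.measurableSet_coe)
  have hfin : volume (⋃ k, (I : Set (Fin m → ℝ)) ∩ ((C k).1 : Set (Fin m → ℝ))) ≠ ⊤ :=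
    ne_top_of_le_ne_top (I.measure_coe_lt_top volume).ne
      (measure_mono (Set.iUnion_subset fun _ => Set.inter_subset_left))
  rw [← measureReal_congr hset, measureReal_def, hmeas]
  rw [hmeas] at hfin
  rw [ENNReal.tsum_toReal_eq fun k => ENNReal.ne_top_of_tsum_ne_top hfin k]
  exact ENNReal.hasSum_toReal hfin

variable [CompleteSpace X]

/-- Cauchy criterion: finite sets of late indices have small total volume, hence small sums of
integrals by absolute continuity. -/
theorem McShaneIntegrable.summable_division (hg : McShaneIntegrable W g) (hC : IsDivision C)
    (hCW : ∀ k, (C k).1 ≤ W) (I : Box (Fin m)) :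
    Summable fun k => extendBot (mcShaneIntegral g) ((I : WithBot (Box (Fin m))) ⊓ (C k).1) := by
  refine summable_iff_vanishing_norm.2 fun ε hε => ?_
  obtain ⟨η, hη, H⟩ := hg.exists_norm_sum_le (half_pos hε)
  obtain ⟨s, hs⟩ := summable_iff_vanishing_norm.1 (hC.hasSum_volume I).summable η hη
  refine ⟨s, fun t ht => ?_⟩
  have hle : ∀ k ∈ t, (I : WithBot (Box (Fin m))) ⊓ (C k).1 ≤ W :=
    fun k _ => inf_le_right.trans (WithBot.coe_le_coe.2 (hCW k))
  have h1 := H (familyPrepartition W t _ hle (hC.pairwise_inf I t)) (by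
    rw [Prepartition.measure_iUnion_toReal, sum_familyPrepartition]
    exact (Real.le_norm_self _).trans_lt (hs t ht))
  rw [sum_familyPrepartition] at h1
  exact h1.trans_lt (half_lt_self hε)

/-- The part of `I` left uncovered by finitely many members eventually has small volume, so absolute
continuity makes its integral small. -/
theorem McShaneIntegrable.hasSum_division (hg : McShaneIntegrable I g) (hC : IsDivision C)
    (hI : volume (Box.Icc I \ ⋃ k, (C k).toSet) = 0) :
    HasSum (fun k => extendBot (mcShaneIntegral g) ((I : WithBot (Box (Fin m))) ⊓ (C k).1))
      (mcShaneIntegral g I) := by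
  have hvol : volume.real (Box.Icc I ∩ ⋃ k, (C k).toSet) = volume.real (I : Set (Fin m → ℝ)) := by
    rw [← volume_real_Icc, measureReal_def, measureReal_def, measure_inter_conull' hI]
  have hs := hC.hasSum_volume I
  rw [hvol] at hs
  refine Metric.tendsto_nhds.2 fun ε hε => ?_
  obtain ⟨η, hη, H⟩ := hg.exists_norm_sum_le (half_pos hε)
  filter_upwards [Metric.tendsto_nhds.1 hs η hη] with t ht
  have hle : ∀ k ∈ t, (I : WithBot (Box (Fin m))) ⊓ (C k).1 ≤ I := fun k _ => inf_le_left
  set π := familyPrepartition I t _ hle (hC.pairwise_inf I t) with hπ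
  have hd : Disjoint π.iUnion π.compl.iUnion := by
    rw [Prepartition.iUnion_compl]; exact Set.disjoint_sdiff_right
  have hpart := Prepartition.isPartitionDisjUnionOfEqDiff π.iUnion_compl
  have hadd := hg.toBoxAdditive.sum_partition_boxes le_rfl hpart
  rw [Prepartition.disjUnion_boxes, Prepartition.sum_disj_union_boxes hd] at hadd
  have hadd' := (volume : Measure (Fin m → ℝ)).toBoxAdditive.sum_partition_boxes le_top hpart
  rw [Prepartition.disjUnion_boxes, Prepartition.sum_disj_union_boxes hd] at hadd'
  simp only [Integrable.toBoxAdditive_apply, Measure.toBoxAdditive_apply] at hadd hadd'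
  have hc := H π.compl (by
    rw [Prepartition.measure_iUnion_toReal]
    rw [hπ, sum_familyPrepartition, ← hπ] at hadd'
    rw [Real.dist_eq] at ht
    linarith [neg_abs_le (∑ k ∈ t, extendBot (fun J => volume.real (J : Set (Fin m → ℝ)))
      ((I : WithBot (Box (Fin m))) ⊓ (C k).1) - volume.real (I : Set (Fin m → ℝ)))])
  rw [hπ, sum_familyPrepartition, ← hπ] at hadd
  rw [dist_eq_norm', sub_eq_iff_eq_add'.2 hadd.symm]
  exact hc.trans_lt (half_lt_self hε)

end Series

/-! ### Dyadic cubes and a locally finite division -/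

section Dyadic

variable {m : ℕ}

/-- The dyadic cube of side `2⁻ⁿ` with lower corner `2⁻ⁿ ν`. -/
def dyadicBox (p : ℕ × (Fin m → ℤ)) : Box (Fin m) where
  lower i := p.2 i / 2 ^ p.1
  upper i := (p.2 i + 1) / 2 ^ p.1
  lower_lt_upper i := by gcongr; linarith

theorem exists_mem_dyadicBox (n : ℕ) (x : Fin m → ℝ) : ∃ ν, x ∈ dyadicBox (n, ν) := by
  -- Boxes are open below and closed above, hence the ceiling minus one instead of the floor.
  refine ⟨fun i => ⌈x i * 2 ^ n⌉ - 1, fun i => ⟨?_, ?_⟩⟩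
  · change ((⌈x i * 2 ^ n⌉ - 1 : ℤ) : ℝ) / 2 ^ n < x i
    rw [div_lt_iff₀ (by positivity)]
    push_cast
    linarith [Int.ceil_lt_add_one (x i * 2 ^ n)]
  · change x i ≤ (((⌈x i * 2 ^ n⌉ - 1 : ℤ) : ℝ) + 1) / 2 ^ n
    rw [le_div_iff₀ (by positivity)]
    push_cast
    linarith [Int.le_ceil (x i * 2 ^ n)]

/-- In units of the finer scale all endpoints are integers, where `a < b + 1` means `a ≤ b`. -/
theorem dyadicBox_le_of_mem {p q : ℕ × (Fin m → ℤ)} (h : q.1 ≤ p.1) {x : Fin m → ℝ}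
    (hp : x ∈ dyadicBox p) (hq : x ∈ dyadicBox q) : dyadicBox p ≤ dyadicBox q := by
  obtain ⟨n, ν⟩ := p
  obtain ⟨k, μ⟩ := q
  obtain ⟨d, rfl⟩ := Nat.exists_eq_add_of_le h
  have key : ∀ i, μ i * 2 ^ d ≤ ν i ∧ ν i + 1 ≤ (μ i + 1) * 2 ^ d := by
    intro i
    have h1 : (ν i : ℝ) / 2 ^ (k + d) < x i := (hp i).1
    have h2 : x i ≤ ((ν i : ℝ) + 1) / 2 ^ (k + d) := (hp i).2
    have h3 : (μ i : ℝ) / 2 ^ k < x i := (hq i).1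
    have h4 : x i ≤ ((μ i : ℝ) + 1) / 2 ^ k := (hq i).2
    have e : ∀ a : ℝ, a / 2 ^ k = a * 2 ^ d / 2 ^ (k + d) := fun a => by
      rw [pow_add, mul_div_mul_right _ _ (by positivity)]
    rw [e] at h3 h4
    have h5 := h3.trans_le h2
    have h6 := h1.trans_le h4
    rw [div_lt_div_iff_of_pos_right (by positivity)] at h5 h6
    constructor
    · exact Int.lt_add_one_iff.1 (by exact_mod_cast h5)
    · exact Int.add_one_le_iff.2 (by exact_mod_cast h6)
  rw [Box.le_iff_bounds]
  constructor <;> intro i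
  · change (μ i : ℝ) / 2 ^ k ≤ (ν i : ℝ) / 2 ^ (k + d)
    rw [pow_add, div_le_div_iff₀ (by positivity) (by positivity)]
    have : (μ i : ℝ) * 2 ^ d ≤ ν i := by exact_mod_cast (key i).1
    nlinarith [pow_pos (two_pos (α := ℝ)) k]
  · change ((ν i : ℝ) + 1) / 2 ^ (k + d) ≤ ((μ i : ℝ) + 1) / 2 ^ k
    rw [pow_add, div_le_div_iff₀ (by positivity) (by positivity)]
    have : (ν i : ℝ) + 1 ≤ ((μ i : ℝ) + 1) * 2 ^ d := by exact_mod_cast (key i).2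
    nlinarith [pow_pos (two_pos (α := ℝ)) k]

theorem Icc_dyadicBox_subset_closedBall {p : ℕ × (Fin m → ℤ)} {x : Fin m → ℝ}
    (hx : x ∈ Box.Icc (dyadicBox p)) :
    Box.Icc (dyadicBox p) ⊆ Metric.closedBall x (1 / 2 ^ p.1) := by
  intro y hy
  rw [Metric.mem_closedBall, dist_pi_le_iff (by positivity)]
  intro i
  have h1 : (p.2 i : ℝ) / 2 ^ p.1 ≤ x i := hx.1 i
  have h2 : x i ≤ ((p.2 i : ℝ) + 1) / 2 ^ p.1 := hx.2 i
  have h3 : (p.2 i : ℝ) / 2 ^ p.1 ≤ y i := hy.1 i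
  have h4 : y i ≤ ((p.2 i : ℝ) + 1) / 2 ^ p.1 := hy.2 i
  rw [add_div] at h2 h4
  rw [Real.dist_eq, abs_le]
  constructor <;> linarith

/-- The maximal dyadic cubes of side at most one whose closure is contained in `U`. -/
def maximalDyadic (U : Set (Fin m → ℝ)) : Set (ℕ × (Fin m → ℤ)) :=
  {p | Box.Icc (dyadicBox p) ⊆ U ∧
    ∀ q : ℕ × (Fin m → ℤ), q.1 < p.1 → dyadicBox p ≤ dyadicBox q → ¬ Box.Icc (dyadicBox q) ⊆ U}

variable {U : Set (Fin m → ℝ)}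

theorem disjoint_of_mem_maximalDyadic {p q : ℕ × (Fin m → ℤ)} (hp : p ∈ maximalDyadic U)
    (hq : q ∈ maximalDyadic U) (hpq : p ≠ q) :
    Disjoint (dyadicBox p : Set (Fin m → ℝ)) (dyadicBox q) := by
  rw [Set.disjoint_left]
  intro x hxp hxq
  rcases lt_trichotomy p.1 q.1 with h | h | h
  · exact hq.2 p h (dyadicBox_le_of_mem h.le hxq hxp) hp.1
  · have h1 := dyadicBox_le_of_mem h.le hxq hxp
    have h2 := dyadicBox_le_of_mem h.ge hxp hxq
    refine hpq (Prod.ext h (funext fun i => ?_))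
    have h3 : (p.2 i : ℝ) / 2 ^ p.1 = (q.2 i : ℝ) / 2 ^ q.1 :=
      congrFun (congrArg Box.lower (le_antisymm h2 h1)) i
    rw [h, div_left_inj' (by positivity)] at h3
    exact_mod_cast h3
  · exact hp.2 q h (dyadicBox_le_of_mem h.le hxp hxq) hq.1

theorem exists_pow_lt_and_ball_subset (hU : IsOpen U) {x : Fin m → ℝ} (hx : x ∈ U) :
    ∃ n : ℕ, Metric.ball x (2 * (1 / 2 ^ n)) ⊆ U := by
  obtain ⟨R, hR, h⟩ := Metric.isOpen_iff.1 hU x hx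
  obtain ⟨n, hn⟩ := exists_pow_lt_of_lt_one (half_pos hR) (one_half_lt_one (α := ℝ))
  rw [one_div, inv_pow, ← one_div] at hn
  exact ⟨n, (Metric.ball_subset_ball (by linarith)).trans h⟩

/-- The coarsest dyadic cube around `x` with closure in `U` is maximal, since any larger cube also
contains `x`. -/
theorem iUnion_maximalDyadic (hU : IsOpen U) :
    ⋃ p ∈ maximalDyadic U, Box.Icc (dyadicBox p) = U := by
  classical
  refine Set.Subset.antisymm (Set.iUnion₂_subset fun p hp => hp.1) fun x hx => ?_
  have hex : ∃ n : ℕ, ∃ ν, x ∈ dyadicBox (n, ν) ∧ Box.Icc (dyadicBox (n, ν)) ⊆ U := by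
    obtain ⟨n, hn⟩ := exists_pow_lt_and_ball_subset hU hx
    obtain ⟨ν, hν⟩ := exists_mem_dyadicBox n x
    refine ⟨n, ν, hν, (Icc_dyadicBox_subset_closedBall (Box.coe_subset_Icc hν)).trans
      ((Metric.closedBall_subset_ball ?_).trans hn)⟩
    have : (0 : ℝ) < 1 / 2 ^ n := by positivity
    change (1 : ℝ) / 2 ^ n < _
    linarith
  obtain ⟨ν, hν, hνU⟩ := Nat.find_spec hex
  refine Set.mem_iUnion₂.2 ⟨(Nat.find hex, ν), ⟨hνU, fun q hq hle hqU => ?_⟩,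
    Box.coe_subset_Icc hν⟩
  exact Nat.find_min hex hq ⟨q.2, hle hν, hqU⟩

/-- A maximal cube meeting a small ball about `t` cannot be finer than level `n`, as its level-`n`
ancestor would still lie in `U`. Bounded level and position leave finitely many cubes. -/
theorem exists_finite_maximalDyadic (hU : IsOpen U) {t : Fin m → ℝ} (ht : t ∈ U) :
    ∃ r : ℝ, 0 < r ∧
      {p ∈ maximalDyadic U | (Box.Icc (dyadicBox p) ∩ Metric.ball t r).Nonempty}.Finite := by
  obtain ⟨n, hn⟩ := exists_pow_lt_and_ball_subset hU ht
  refine ⟨1 / 2 ^ n, by positivity, ?_⟩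
  -- The `2` allows for the radius of the ball and the side of the cube, each at most one.
  obtain ⟨N, hN⟩ := exists_nat_ge ((2 : ℝ) ^ n * (‖t‖ + 2))
  refine ((Set.finite_Iic n).prod
    (Set.finite_Icc (fun _ : Fin m => -(N : ℤ)) (fun _ => (N : ℤ)))).subset ?_
  rintro p ⟨hp, y, hyp, hyt⟩
  have hpn : p.1 ≤ n := by
    by_contra hlt
    push Not at hlt
    obtain ⟨ν, hν⟩ := exists_mem_dyadicBox n (dyadicBox p).upper
    have hle : dyadicBox p ≤ dyadicBox (n, ν) :=
      dyadicBox_le_of_mem hlt.le (dyadicBox p).upper_mem hν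
    refine hp.2 (n, ν) hlt hle ((Icc_dyadicBox_subset_closedBall
      (Box.le_iff_Icc.1 hle hyp)).trans ((Metric.closedBall_subset_ball' ?_).trans hn))
    change 1 / 2 ^ n + dist y t < _
    linarith [Metric.mem_ball.1 hyt]
  have hbound : ∀ i, |(p.2 i : ℝ)| ≤ N := by
    intro i
    have h1 := Metric.mem_closedBall.1 (Icc_dyadicBox_subset_closedBall hyp
      (dyadicBox p).lower_mem_Icc)
    have h2 : ∀ k : ℕ, (1 : ℝ) / 2 ^ k ≤ 1 := fun k =>
      div_le_one_of_le₀ (one_le_pow₀ one_le_two) (by positivity)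
    have h3 : ‖(dyadicBox p).lower‖ ≤ ‖t‖ + 2 := by
      have h4 := dist_triangle (dyadicBox p).lower y t
      have h5 := norm_le_norm_add_norm_sub' (dyadicBox p).lower t
      rw [← dist_eq_norm] at h5
      linarith [h2 p.1, h2 n, Metric.mem_ball.1 hyt]
    have h6 : |(p.2 i : ℝ) / 2 ^ p.1| ≤ ‖t‖ + 2 := (norm_le_pi_norm (dyadicBox p).lower i).trans h3
    rw [abs_div, abs_of_pos (show (0 : ℝ) < 2 ^ p.1 by positivity),
      div_le_iff₀ (by positivity)] at h6
    refine (h6.trans ?_).trans hN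
    rw [mul_comm]
    gcongr
    exact one_le_two
  refine ⟨hpn, fun i => ?_, fun i => ?_⟩
  · exact_mod_cast (abs_le.1 (hbound i)).1
  · exact_mod_cast (abs_le.1 (hbound i)).2

/-- A division is an infinite sequence. Finitely many closed cubes would make `U` clopen, hence the
whole space, which is not compact when `m ≥ 1`. -/
theorem infinite_maximalDyadic (hm : 1 ≤ m) (hU : IsOpen U) (hne : U.Nonempty)
    (hb : Bornology.IsBounded U) : (maximalDyadic U).Infinite := by
  intro hfin
  have hclosed : IsClosed U := by
    rw [← iUnion_maximalDyadic hU]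
    exact hfin.isClosed_biUnion fun p _ => (dyadicBox p).isCompact_Icc.isClosed
  have huniv : U = Set.univ := IsClopen.eq_univ ⟨hclosed, hU⟩ hne
  have : Nonempty (Fin m) := ⟨⟨0, hm⟩⟩
  have : NoncompactSpace (Fin m → ℝ) := NormedSpace.noncompactSpace ℝ _
  exact noncompact_univ (Fin m → ℝ)
    (huniv ▸ Metric.isCompact_of_isClosed_isBounded hclosed hb)

/-- A nonempty bounded open set has a locally finite division. -/
theorem exists_isDivisionOf_locallyFinite {E : Set (Fin m → ℝ)} (hm : 1 ≤ m) (hU : IsOpen U)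
    (hne : U.Nonempty) (hb : Bornology.IsBounded U) (hUE : U ⊆ E) :
    ∃ C : ℕ → Subinterval E, IsDivisionOf U C ∧ ∀ t ∈ U, ∃ r : ℝ, 0 < r ∧
      {k | ((C k).toSet ∩ Metric.ball t r).Nonempty}.Finite := by
  have : Infinite (maximalDyadic U) := (infinite_maximalDyadic hm hU hne hb).to_subtype
  obtain ⟨e⟩ : Nonempty (ℕ ≃ maximalDyadic U) := by
    obtain ⟨_⟩ := nonempty_denumerable (maximalDyadic U)
    exact ⟨(Denumerable.eqv _).symm⟩
  refine ⟨fun k => ⟨dyadicBox (e k), (e k).2.1.trans hUE⟩, ⟨fun j k hjk => ?_, ?_⟩, fun t ht => ?_⟩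
  · refine nonOverlapping_iff.2 (Box.disjoint_coe.2 ?_)
    exact disjoint_of_mem_maximalDyadic (e j).2 (e k).2
      (fun h => hjk (e.injective (Subtype.ext h)))
  · refine Eq.trans ?_ (iUnion_maximalDyadic hU)
    ext x
    rw [Set.mem_iUnion, Set.mem_iUnion₂]
    constructor
    · rintro ⟨k, hk⟩
      exact ⟨e k, (e k).2, hk⟩
    · rintro ⟨p, hp, hx⟩
      refine ⟨e.symm ⟨p, hp⟩, ?_⟩
      change x ∈ Box.Icc (dyadicBox (e (e.symm ⟨p, hp⟩)))
      rwa [e.apply_symm_apply]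
  · obtain ⟨r, hr, hfin⟩ := exists_finite_maximalDyadic hU ht
    refine ⟨r, hr, ?_⟩
    refine (hfin.preimage (f := fun k => (e k : ℕ × (Fin m → ℤ)))
      (Subtype.val_injective.comp e.injective).injOn).subset fun k hk => ?_
    exact ⟨(e k).2, hk⟩

end Dyadic

/-! ### Extension by zero and the three implications -/

section Equivalence

variable {m : ℕ} {G : Set (Fin m → ℝ)} {X : Type*} [NormedAddCommGroup X] [NormedSpace ℝ X]
  {I₀ : Box (Fin m)} {f : G → X} {F : Subinterval G → X}

omit [NormedSpace ℝ X] in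
theorem zeroExt_of_mem {t : Fin m → ℝ} (ht : t ∈ G) : zeroExt f t = f ⟨t, ht⟩ := dif_pos ht

omit [NormedSpace ℝ X] in
theorem zeroExt_of_notMem {t : Fin m → ℝ} (ht : t ∉ G) : zeroExt f t = 0 := dif_neg ht

omit [NormedSpace ℝ X] in
theorem zeroExt_zeroExt {S : Set (Fin m → ℝ)} (hS : G ⊆ S) :
    zeroExt (fun t : S => zeroExt f t) = zeroExt f := by
  funext t
  by_cases ht : t ∈ S
  · rw [zeroExt_of_mem ht]
  · rw [zeroExt_of_notMem ht, zeroExt_of_notMem fun h => ht (hS h)]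

omit [NormedSpace ℝ X] in
theorem eqOn_zeroExt_inclusion {S : Set (Fin m → ℝ)} (hS : S ⊆ G) :
    Set.EqOn (zeroExt fun t : S => f (Set.inclusion hS t)) (zeroExt f) S := fun t ht => by
  rw [zeroExt_of_mem ht, zeroExt_of_mem (hS ht)]

-- `f` may be nonzero at boundary points belonging to `G`. Erasing these values removes the Riemann
-- terms at tags outside the interior, matching negligible variation, which involves `F` alone.
omit [NormedSpace ℝ X] in
theorem zeroExt_ae_eq_indicator (hG0 : volume (G \ interior G) = 0) :
    zeroExt f =ᵐ[volume] (interior G).indicator (zeroExt f) := by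
  refine measure_mono_null (fun t ht => ?_) hG0
  by_contra h
  refine ht ?_
  by_cases hi : t ∈ interior G
  · exact (Set.indicator_of_mem hi _).symm
  · have hG : t ∉ G := fun hG => h ⟨hG, hi⟩
    change zeroExt f t = (interior G).indicator (zeroExt f) t
    rw [Set.indicator_of_notMem hi, zeroExt_of_notMem hG]

/-- A bound for all fine partitions bounds the sums over finite sets of boxes of a tagged
prepartition. -/
theorem norm_sum_boxes_lt {U : Set (Fin m → ℝ)} {Y : Type*} [NormedAddCommGroup Y] {ε : ℝ}
    {δ : (Fin m → ℝ) → ℝ} {Z : Set (Fin m → ℝ)} {v : Z → Subinterval U → Y}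
    (H : ∀ π : Finset (Z × Subinterval U),
      (π : Set (Z × Subinterval U)).Pairwise (fun p q => NonOverlapping p.2.1 q.2.1) →
      (∀ p ∈ π, p.2.toSet ⊆ Metric.ball (p.1 : Fin m → ℝ) (δ p.1)) →
      ‖∑ p ∈ π, v p.1 p.2‖ < ε)
    {W : Box (Fin m)} (π : TaggedPrepartition W) (s : Finset (Box (Fin m))) (hs : s ⊆ π.boxes)
    (w : Box (Fin m) → Y)
    (hfine : ∀ K ∈ s, Box.Icc K ⊆ Metric.ball (π.tag K) (δ (π.tag K)))
    (hw : ∀ K ∈ s, ∃ (ht : π.tag K ∈ Z) (hK : Box.Icc K ⊆ U), v ⟨_, ht⟩ ⟨K, hK⟩ = w K) :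
    ‖∑ K ∈ s, w K‖ < ε := by
  classical
  choose ht hK hv using hw
  let e : s ↪ Z × Subinterval U :=
    ⟨fun K => (⟨π.tag K, ht K.1 K.2⟩, ⟨K, hK K.1 K.2⟩), fun K L h =>
      Subtype.ext (congrArg (fun p : Z × Subinterval U => p.2.1) h)⟩
  have := H (s.attach.map e) ?_ ?_
  · rw [Finset.sum_map] at this
    refine (congrArg norm ?_).trans_lt this
    rw [← Finset.sum_attach]
    exact Finset.sum_congr rfl fun K _ => (hv K.1 K.2).symm
  · intro p hp q hq hpq
    obtain ⟨K, -, rfl⟩ := Finset.mem_map.1 (Finset.mem_coe.1 hp)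
    obtain ⟨L, -, rfl⟩ := Finset.mem_map.1 (Finset.mem_coe.1 hq)
    refine nonOverlapping_iff.2 (Box.disjoint_coe.2 ?_)
    exact π.disjoint_coe_of_mem (hs K.2) (hs L.2) fun h => hpq (congrArg e (Subtype.ext h))
  · intro p hp
    obtain ⟨K, -, rfl⟩ := Finset.mem_map.1 hp
    exact hfine K K.2

-- Additivity is used on `J ∩ D`, which lies in `G` even if `J` does not.
omit [NormedSpace ℝ X] in
theorem interTerm_eq_sum (hF : IsAdditive F) {J : Box (Fin m)} {π : Prepartition J}
    (hπ : π.IsPartition) (D : Subinterval G) :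
    interTerm F J D = ∑ K ∈ π.boxes, interTerm F K D := by
  simp only [interTerm_eq]
  have hle : ∀ K ∈ π.boxes, (K : WithBot (Box (Fin m))) ⊓ D.1 ≤ (J : WithBot (Box (Fin m))) ⊓ D.1 :=
    fun K hK => inf_le_inf_right _ (WithBot.coe_le_coe.2 (π.le_of_mem hK))
  rcases hB : (J : WithBot (Box (Fin m))) ⊓ D.1 with _ | B
  · refine (Finset.sum_eq_zero fun K hK => ?_).symm
    have := hle K hK
    rw [hB] at this
    rw [show (K : WithBot (Box (Fin m))) ⊓ D.1 = ⊥ from le_bot_iff.1 this, extendBot_bot]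
  · have hBG : Box.Icc B ⊆ G := by
      rw [Icc_of_inf_eq hB]; exact Set.inter_subset_right.trans D.2
    refine (sum_extendBot_of_iUnion_eq (hF.toBoxAdditive ⟨B, hBG⟩)
      (fun K hK => (hle K hK).trans_eq hB) (fun K hK L hL hne => ?_) ?_).symm
    · exact (Box.disjoint_coe.2 (π.disjoint_coe_of_mem hK hL hne)).mono inf_le_left inf_le_left
    · simp only [Box.coe_inf, ← Set.iUnion_inter]
      change (⋃ K ∈ π.boxes, (K : Set (Fin m → ℝ))) ∩ (D.1 : Set (Fin m → ℝ)) = _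
      rw [← Prepartition.iUnion_def', hπ.iUnion_eq, coe_of_inf_eq hB]

theorem interTerm_eq_mcShaneIntegral
    (hprim : ∀ I : Subinterval G, mcShaneIntegral (zeroExt f) I.1 = F I)
    (I : Box (Fin m)) (D : Subinterval G) :
    interTerm F I D =
      extendBot (mcShaneIntegral (zeroExt f)) ((I : WithBot (Box (Fin m))) ⊓ D.1) := by
  rw [interTerm_eq]
  refine extendBot_congr fun J hJ => ?_
  have hJG : Box.Icc J ⊆ G := by
    rw [Icc_of_inf_eq hJ]; exact Set.inter_subset_right.trans D.2
  rw [boxFun_of_subset F hJG]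
  exact (hprim ⟨J, hJG⟩).symm

variable [CompleteSpace X]

theorem restriction_mcShaneIntegrableWithPrimitive_iff (D : Subinterval G) :
    McShaneIntegrableWithPrimitive D.1 (fun t => f (Set.inclusion D.2 t))
      (fun J => F (J.incl D.2)) ↔
    McShaneIntegrable D.1 (zeroExt f) ∧
      ∀ J : Subinterval (Box.Icc D.1), mcShaneIntegral (zeroExt f) J.1 = F (J.incl D.2) := by
  rw [mcShaneIntegrableWithPrimitive_iff]
  have heq := eqOn_zeroExt_inclusion (f := f) D.2
  constructor
  · rintro ⟨h, h'⟩
    refine ⟨h.congr heq, fun J => ?_⟩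
    rw [← h' J]
    exact mcShaneIntegral_congr (h.to_subbox (Box.le_iff_Icc.2 J.2)) (heq.mono J.2)
  · rintro ⟨h, h'⟩
    refine ⟨h.congr heq.symm, fun J => ?_⟩
    rw [← h' J]
    exact mcShaneIntegral_congr (h.to_subbox (Box.le_iff_Icc.2 J.2)) (heq.symm.mono J.2)

/-- McShane integrability of the extension by zero, with the given primitive on the
subintervals. -/
theorem exists_primitive_iff (hI₀ : G ⊆ Box.Icc I₀) :
    (∃ F₀ : Subinterval (Box.Icc I₀) → X,
        McShaneIntegrableWithPrimitive I₀ (fun t => zeroExt f t) F₀ ∧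
        ∀ I : Subinterval G, F₀ (I.incl hI₀) = F I) ↔
      McShaneIntegrable I₀ (zeroExt f) ∧
        ∀ I : Subinterval G, mcShaneIntegral (zeroExt f) I.1 = F I := by
  simp only [mcShaneIntegrableWithPrimitive_iff, zeroExt_zeroExt hI₀]
  constructor
  · rintro ⟨F₀, ⟨h, h1⟩, h2⟩
    exact ⟨h, fun I => (h1 (I.incl hI₀)).trans (h2 I)⟩
  · rintro ⟨h, h'⟩
    exact ⟨fun J => mcShaneIntegral (zeroExt f) J.1, ⟨h, fun _ => rfl⟩, h'⟩

/-! ### From the McShane integral to the conditions on `F` -/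

section McShaneToDunford

variable (hG0 : volume (G \ interior G) = 0) (hI₀ : G ⊆ Box.Icc I₀)
  (hint : McShaneIntegrable I₀ (zeroExt f))
  (hprim : ∀ I : Subinterval G, mcShaneIntegral (zeroExt f) I.1 = F I)

include hG0 hI₀ hint hprim

/-- A McShane primitive is a Dunford-function. -/
theorem isDunfordFunction_of_mcShaneIntegrable (hF : IsAdditive F) : IsDunfordFunction F where
  additive := hF
  summable C hC I := by
    simp only [interTerm_eq_mcShaneIntegral hprim]
    exact hint.summable_division hC (fun k => Box.le_iff_Icc.2 ((C k).2.trans hI₀)) I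
  hasSum C hC I := by
    simp only [interTerm_eq_mcShaneIntegral hprim]
    rw [← hprim I]
    refine McShaneIntegrable.hasSum_division
      (hint.to_subbox (Box.le_iff_Icc.2 (I.2.trans hI₀))) hC.1 ?_
    rw [hC.2]
    exact measure_mono_null (Set.sdiff_subset_sdiff_left I.2) hG0

/-- Henstock's lemma for the pieces `I ∩ C k`: the Riemann terms vanish at tags outside the
interior, leaving values of `F`. The bound is uniform over finite sets of `k`, so it passes to the
full series. -/
theorem hasNegligibleVariationOutside_of_mcShaneIntegrable :
    HasNegligibleVariationOutside F := by
  intro ε hε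
  have hae := zeroExt_ae_eq_indicator (f := f) hG0
  have hint' : McShaneIntegrable I₀ ((interior G).indicator (zeroExt f)) :=
    hint.congr_ae (ae_restrict_of_ae hae)
  obtain ⟨δ, hδ, H⟩ := hint'.exists_gauge (half_pos hε)
  -- Tags range over the whole space, but Henstock's lemma wants them in `I₀`; the others get boxes
  -- missing `I₀`, hence empty pieces.
  have hρ : ∀ t, ∃ ρ : ℝ, 0 < ρ ∧ (t ∉ Box.Icc I₀ → Metric.ball t ρ ⊆ (Box.Icc I₀)ᶜ) := by
    intro t
    by_cases ht : t ∈ Box.Icc I₀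
    · exact ⟨1, one_pos, fun h => (h ht).elim⟩
    · obtain ⟨ρ, hρ, h⟩ := Metric.isOpen_iff.1 I₀.isCompact_Icc.isClosed.isOpen_compl t ht
      exact ⟨ρ, hρ, fun _ => h⟩
  choose ρ hρ0 hρ1 using hρ
  refine ⟨fun t => min (δ t) (ρ t), fun t _ => lt_min (hδ t) (hρ0 t), ?_⟩
  intro π hπ htag hfine C hC
  have hCI : ∀ k, (C k).1 ≤ I₀ := fun k => Box.le_iff_Icc.2 ((C k).2.trans hI₀)
  have hsum : ∀ p ∈ π, Summable fun k => interTerm F p.2.1 (C k) := fun p _ => by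
    simp only [interTerm_eq_mcShaneIntegral hprim]
    exact hint.summable_division hC.1 hCI p.2.1
  refine ⟨hsum, lt_of_le_of_lt ?_ (half_lt_self hε)⟩
  refine le_of_tendsto (hasSum_sum fun p hp => (hsum p hp).hasSum).norm
    (Filter.Eventually.of_forall fun s => ?_)
  have key := H (π ×ˢ s)
    (fun i => (i.1.2.1 : WithBot (Box (Fin m))) ⊓ (C i.2).1) (fun i => i.1.1)
    (fun i _ => inf_le_right.trans (WithBot.coe_le_coe.2 (hCI i.2))) ?_ ?_
  · rw [Finset.sum_product_right, ← norm_neg, ← Finset.sum_neg_distrib] at key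
    refine le_trans (le_of_eq (congrArg norm ?_)) key
    refine Finset.sum_congr rfl fun k _ => ?_
    rw [← Finset.sum_neg_distrib]
    refine Finset.sum_congr rfl fun p hp => ?_
    rw [interTerm_eq_mcShaneIntegral hprim, extendBot_sub, Set.indicator_of_notMem (htag p hp)]
    rcases hB : (p.2.1 : WithBot (Box (Fin m))) ⊓ (C k).1 with _ | B
    · change (0 : X) = -(0 - 0)
      simp
    · change mcShaneIntegral _ B = -(_ • (0 : X) - mcShaneIntegral _ B)
      have hBI : B ≤ I₀ := by
        refine WithBot.coe_le_coe.1 (hB.symm.trans_le ?_)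
        exact inf_le_right.trans (WithBot.coe_le_coe.2 (hCI k))
      rw [smul_zero, zero_sub, neg_neg,
        mcShaneIntegral_congr_ae (hint.to_subbox hBI) (ae_restrict_of_ae hae)]
  · rintro ⟨p, k⟩ hp ⟨q, l⟩ hq hne
    rw [Finset.coe_product, Set.mem_prod] at hp hq
    by_cases hpq : p = q
    · subst hpq
      have hkl : k ≠ l := fun h => hne (by rw [h])
      exact (hC.1.disjoint hkl).mono inf_le_right inf_le_right
    · exact (nonOverlapping_iff.1 (hπ hp.1 hq.1 hpq)).mono inf_le_left inf_le_left
  · rintro ⟨p, k⟩ hp B hB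
    have hp' := (Finset.mem_product.1 hp).1
    have hBI := Icc_of_inf_eq hB
    have hball := hfine p hp'
    refine ⟨?_, ?_⟩
    · by_contra ht
      have hup := B.upper_mem_Icc
      rw [hBI] at hup
      exact hρ1 _ ht (Metric.ball_subset_ball (min_le_right _ _) (hball hup.1))
        (hI₀ ((C k).2 hup.2))
    · rw [hBI]
      exact Set.inter_subset_left.trans (hball.trans
        ((Metric.ball_subset_ball (min_le_left _ _)).trans Metric.ball_subset_closedBall))

end McShaneToDunford

/-! ### From Dunford–McShane to McShane -/

omit [CompleteSpace X] in
/-- The McShane integral of a Dunford-McShane integrable function, computed from a division of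
the interior of its domain. -/
theorem DunfordMcShaneIntegrableWithPrimitive.hasMcShaneIntegral
    (H : DunfordMcShaneIntegrableWithPrimitive f F) (hG0 : volume (G \ interior G) = 0)
    {C : ℕ → Subinterval G} (hC : IsDivisionOf (interior G) C) (J : Box (Fin m)) :
    HasMcShaneIntegral J (zeroExt f) (∑' k, interTerm F J (C k)) := by
  classical
  have hae := zeroExt_ae_eq_indicator (f := f) hG0
  suffices HasMcShaneIntegral J ((interior G).indicator (zeroExt f))
      (∑' k, interTerm F J (C k)) from
    HasIntegral.congr_ae this (ae_restrict_of_ae hae.symm) rfl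
  refine hasMcShaneIntegral_of_forall fun ε hε => ?_
  obtain ⟨δ₁, hδ₁, H₁⟩ := H.approx (ε / 2) (half_pos hε)
  obtain ⟨δ₂, hδ₂, H₂⟩ := H.negligible (ε / 2) (half_pos hε)
  -- Boxes with interior tags are kept in the interior, so that the Dunford property sums their
  -- series to `F K`.
  have hδ : ∀ t, ∃ d : ℝ, 0 < d ∧
      (t ∈ interior G → Metric.closedBall t d ⊆ Metric.ball t (δ₁ t) ∩ interior G) ∧
      (t ∉ interior G → Metric.closedBall t d ⊆ Metric.ball t (δ₂ t)) := by
    intro t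
    by_cases ht : t ∈ interior G
    · obtain ⟨d, hd, h⟩ := Metric.nhds_basis_closedBall.mem_iff.1
        (Filter.inter_mem (Metric.ball_mem_nhds t (hδ₁ t ht)) (isOpen_interior.mem_nhds ht))
      exact ⟨d, hd, fun _ => h, fun h' => (h' ht).elim⟩
    · obtain ⟨d, hd, h⟩ := Metric.nhds_basis_closedBall.mem_iff.1
        (Metric.ball_mem_nhds t (hδ₂ t ht))
      exact ⟨d, hd, fun h' => (ht h').elim, fun _ => h⟩
  choose δ hδ0 hδU hδZ using hδ
  refine ⟨δ, hδ0, fun π hπ hp => ?_⟩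
  -- The candidate integral is additive over `π`, as finite sums commute with convergent series.
  have htsum : ∑' k, interTerm F J (C k) =
      ∑ K ∈ π.boxes, ∑' k, interTerm F K (C k) := by
    rw [← Summable.tsum_finsetSum fun K _ => H.dunford.summable C hC.1 K]
    exact tsum_congr fun k => interTerm_eq_sum H.dunford.additive hp (C k)
  rw [htsum, ← Finset.sum_sub_distrib,
    ← Finset.sum_filter_add_sum_filter_not π.boxes (fun K => π.tag K ∈ interior G)]
  have hin : ‖∑ K ∈ π.boxes.filter (fun K => π.tag K ∈ interior G),
      (volume.real (K : Set (Fin m → ℝ)) • (interior G).indicator (zeroExt f) (π.tag K) -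
        ∑' k, interTerm F K (C k))‖ < ε / 2 := by
    refine norm_sum_boxes_lt (v := fun t K => volume.real K.toSet •
      f (Set.inclusion interior_subset t) - F (K.incl interior_subset)) H₁ π _
      (Finset.filter_subset _ _) _ (fun K hK => ?_) fun K hK => ?_
    all_goals
      obtain ⟨hK, ht⟩ := Finset.mem_filter.1 hK
      have hsub := (hπ K hK).trans (hδU _ ht)
    · exact hsub.trans Set.inter_subset_left
    · refine ⟨ht, hsub.trans Set.inter_subset_right, ?_⟩
      rw [Set.indicator_of_mem ht, zeroExt_of_mem (interior_subset ht), ← volume_real_Icc]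
      refine congrArg _ ?_
      exact (H.dunford.hasSum C hC
        ⟨K, (hsub.trans Set.inter_subset_right).trans interior_subset⟩).tsum_eq.symm
  have hout : ‖∑ K ∈ π.boxes.filter (fun K => π.tag K ∉ interior G),
      ∑' k, interTerm F K (C k)‖ < ε / 2 := by
    refine norm_sum_boxes_lt (Z := (interior G)ᶜ) (U := Set.univ) (δ := δ₂)
      (v := fun _ K => ∑' k, interTerm F K.1 (C k)) (fun ϖ hϖ hfine => ?_) π _
      (Finset.filter_subset _ _) _ (fun K hK => ?_) fun K hK => ?_
    · have := (H₂ (ϖ.map ⟨fun p => (⟨p.1, trivial⟩, p.2), fun p q h => ?_⟩) ?_ ?_ ?_ C hC).2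
      · rwa [Finset.sum_map] at this
      · exact Prod.ext (Subtype.ext (congrArg (fun r => r.1.1) h)) (Prod.ext_iff.1 h).2
      · intro p hp q hq hpq
        obtain ⟨p', hp', rfl⟩ := Finset.mem_map.1 (Finset.mem_coe.1 hp)
        obtain ⟨q', hq', rfl⟩ := Finset.mem_map.1 (Finset.mem_coe.1 hq)
        exact hϖ hp' hq' fun h => hpq (by rw [h])
      · intro p hp
        obtain ⟨p', hp', rfl⟩ := Finset.mem_map.1 hp
        exact p'.1.2
      · intro p hp
        obtain ⟨p', hp', rfl⟩ := Finset.mem_map.1 hp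
        exact hfine p' hp'
    all_goals obtain ⟨hK, ht⟩ := Finset.mem_filter.1 hK
    · exact (hπ K hK).trans (hδZ _ ht)
    · exact ⟨ht, Set.subset_univ _, rfl⟩
  have hout' : ∑ K ∈ π.boxes.filter (fun K => π.tag K ∉ interior G),
      (volume.real (K : Set (Fin m → ℝ)) • (interior G).indicator (zeroExt f) (π.tag K) -
        ∑' k, interTerm F K (C k)) = -∑ K ∈ π.boxes.filter (fun K => π.tag K ∉ interior G),
      ∑' k, interTerm F K (C k) := by
    rw [← Finset.sum_neg_distrib]
    refine Finset.sum_congr rfl fun K hK => ?_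
    rw [Set.indicator_of_notMem (Finset.mem_filter.1 hK).2, smul_zero, zero_sub]
  rw [hout', ← sub_eq_add_neg]
  refine (norm_sub_le _ _).trans ?_
  linarith

/-! ### From a locally finite division to the approximation condition -/

/-- The approximation condition follows from McShane integrability on the members of a locally
finite division. -/
theorem exists_gauge_interior_of_division (hF : IsDunfordFunction F) {C : ℕ → Subinterval G}
    (hC : IsDivisionOf (interior G) C)
    (hfin : ∀ t ∈ interior G, ∃ r : ℝ, 0 < r ∧
      {k | ((C k).toSet ∩ Metric.ball t r).Nonempty}.Finite)
    (hint : ∀ k, McShaneIntegrable (C k).1 (zeroExt f))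
    (hprim : ∀ k, ∀ J : Subinterval (Box.Icc (C k).1),
      mcShaneIntegral (zeroExt f) J.1 = F (J.incl (C k).2)) {ε : ℝ} (hε : 0 < ε) :
    ∃ δ : (Fin m → ℝ) → ℝ, IsGaugeOn (interior G) δ ∧
      ∀ π : Finset (interior G × Subinterval (interior G)), IsPartition π → IsFine δ π →
        ‖∑ p ∈ π, (volume.real p.2.toSet • f (Set.inclusion interior_subset p.1) -
          F (p.2.incl interior_subset))‖ < ε := by
  -- These errors sum to `ε / 2`, leaving room for the strict inequality.
  have hεk : ∀ k : ℕ, 0 < ε / 2 / 2 / 2 ^ k := fun k => by positivity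
  choose δ hδ H using fun k => (hint k).exists_gauge (hεk k)
  -- By local finiteness one radius avoids all members not containing `t` and stays below the gauges
  -- of those it meets. Every tag then lies in each member that its box meets, as Henstock's lemma
  -- there requires.
  have hd : ∀ t ∈ interior G, ∃ d : ℝ, 0 < d ∧
      ∀ k, ((C k).toSet ∩ Metric.ball t d).Nonempty → t ∈ (C k).toSet ∧ d ≤ δ k t := by
    intro t ht
    obtain ⟨r, hr, hS⟩ := hfin t ht
    have hsmall : ∀ c : ℝ, 0 < c → ∀ᶠ d in 𝓝[>] (0 : ℝ), d ≤ c := fun c hc =>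
      (eventually_le_nhds hc).filter_mono nhdsWithin_le_nhds
    have hall : ∀ᶠ d in 𝓝[>] (0 : ℝ), ∀ k ∈ {k | ((C k).toSet ∩ Metric.ball t r).Nonempty},
        ((C k).toSet ∩ Metric.ball t d).Nonempty → t ∈ (C k).toSet ∧ d ≤ δ k t := by
      refine (Filter.eventually_all_finite hS).2 fun k _ => ?_
      by_cases htk : t ∈ (C k).toSet
      · filter_upwards [hsmall _ (hδ k t)] with d hd _ using ⟨htk, hd⟩
      · obtain ⟨ρ, hρ, h⟩ := Metric.isOpen_iff.1
          (C k).1.isCompact_Icc.isClosed.isOpen_compl t htk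
        filter_upwards [hsmall ρ hρ] with d hd hne
        obtain ⟨y, hy, hyt⟩ := hne
        exact (h (Metric.ball_subset_ball hd hyt) hy).elim
    obtain ⟨d, ⟨hd, hdr⟩, hd0⟩ := ((hall.and (hsmall r hr)).and self_mem_nhdsWithin).exists
    exact ⟨d, hd0, fun k hk => hd k
      (hk.mono (Set.inter_subset_inter_right _ (Metric.ball_subset_ball hdr))) hk⟩
  choose! d hd0 hdC using hd
  refine ⟨d, hd0, fun π hπ hfine => (?_ : _ ≤ ε / 2).trans_lt (half_lt_self hε)⟩
  -- Volume and `F` both decompose along the division, so each error is the series of the errors on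
  -- its members.
  have hterm : ∀ p : interior G × Subinterval (interior G), HasSum
      (fun k => extendBot (fun J => volume.real (J : Set (Fin m → ℝ)) • zeroExt f p.1 -
        mcShaneIntegral (zeroExt f) J) ((p.2.1 : WithBot (Box (Fin m))) ⊓ (C k).1))
      (volume.real p.2.toSet • f (Set.inclusion interior_subset p.1) -
        F (p.2.incl interior_subset)) := by
    intro p
    have hvol := hC.1.hasSum_volume p.2.1
    rw [hC.2, Set.inter_eq_left.2 p.2.2] at hvol
    have h1 := hvol.smul_const (zeroExt f (p.1 : Fin m → ℝ))
    have h2 := h1.sub (hF.hasSum C hC (p.2.incl interior_subset))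
    rw [show zeroExt f (p.1 : Fin m → ℝ) = f (Set.inclusion interior_subset p.1) from
      zeroExt_of_mem (interior_subset p.1.2)] at h2 ⊢
    refine h2.congr_fun fun k => ?_
    change _ = extendBot _ _ • _ - interTerm F p.2.1 (C k)
    rw [interTerm_eq]
    rcases hB : (p.2.1 : WithBot (Box (Fin m))) ⊓ (C k).1 with _ | J
    · change (0 : X) = (0 : ℝ) • _ - 0
      rw [zero_smul, sub_zero]
    · have hJ : Box.Icc J ⊆ Box.Icc (C k).1 := by
        rw [Icc_of_inf_eq hB]; exact Set.inter_subset_right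
      change volume.real (J : Set (Fin m → ℝ)) • _ - mcShaneIntegral _ J =
        volume.real (J : Set (Fin m → ℝ)) • _ - boxFun F J
      rw [boxFun_of_subset F (hJ.trans (C k).2), hprim k ⟨J, hJ⟩]
      rfl
  refine (hasSum_sum fun p _ => hterm p).norm_le_of_bounded (hasSum_geometric_two' (ε / 2))
    fun k => ?_
  have hmeet : ∀ p ∈ π, ∀ J : Box (Fin m), (p.2.1 : WithBot (Box (Fin m))) ⊓ (C k).1 = J →
      (p.1 : Fin m → ℝ) ∈ (C k).toSet ∧ d p.1 ≤ δ k p.1 := by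
    intro p hp J hJ
    have hup := J.upper_mem_Icc
    rw [Icc_of_inf_eq hJ] at hup
    exact hdC p.1 p.1.2 k ⟨J.upper, hup.2, hfine p hp hup.1⟩
  refine H k π (fun p => (p.2.1 : WithBot (Box (Fin m))) ⊓ (C k).1) (fun p => p.1)
    (fun _ _ => inf_le_right)
    (fun p hp q hq hpq => (nonOverlapping_iff.1 (hπ hp hq hpq)).mono inf_le_left inf_le_left)
    fun p hp J hJ => ?_
  obtain ⟨h1, h2⟩ := hmeet p hp J hJ
  refine ⟨h1, ?_⟩
  rw [Icc_of_inf_eq hJ]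
  exact Set.inter_subset_left.trans ((hfine p hp).trans
    ((Metric.ball_subset_ball h2).trans Metric.ball_subset_closedBall))

end Equivalence

end DunfordMcShane

end

theorem theorem2p1 {m : ℕ} (hm : 1 ≤ m)
    {X : Type*} [NormedAddCommGroup X] [NormedSpace ℝ X] [CompleteSpace X]
    (G : Set (Fin m → ℝ)) (hGb : Bornology.IsBounded G) (hGi : (interior G).Nonempty)
    (hG0 : volume (G \ interior G) = 0)
    (I₀ : Box (Fin m)) (hI₀ : G ⊆ Box.Icc I₀)
    (f : G → X) (F : Subinterval G → X) (hF : IsAdditive F) :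
    List.TFAE [
      -- (i)
      DunfordMcShaneIntegrableWithPrimitive f F,
      -- (ii)
      ∃ F₀ : Subinterval (Box.Icc I₀) → X,
        McShaneIntegrableWithPrimitive I₀ (fun t => zeroExt f t) F₀ ∧
        ∀ I : Subinterval G, F₀ (I.incl hI₀) = F I,
      -- (iii)
      IsDunfordFunction F ∧ HasNegligibleVariationOutside F ∧
        ∀ C : ℕ → Subinterval G, IsDivisionOf (interior G) C → ∀ k,
          McShaneIntegrableWithPrimitive (C k).1
            (fun t => f (Set.inclusion (C k).2 t)) (fun J => F (J.incl (C k).2))] := by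
  -- Local finiteness matters only from (iii) to (i); from (i) to (ii) any division of the interior
  -- would do.
  obtain ⟨C, hC, hfin⟩ := exists_isDivisionOf_locallyFinite hm isOpen_interior hGi
    (hGb.subset interior_subset) (interior_subset (s := G))
  rw [exists_primitive_iff hI₀]
  tfae_have 1 → 2 := fun H => by
    refine ⟨(H.hasMcShaneIntegral hG0 hC I₀).integrable, fun I => ?_⟩
    exact (H.hasMcShaneIntegral hG0 hC I.1).integral_eq.trans (H.dunford.hasSum C hC I).tsum_eq
  tfae_have 2 → 3 := fun ⟨hint, hprim⟩ => by
    refine ⟨isDunfordFunction_of_mcShaneIntegrable hG0 hI₀ hint hprim hF,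
      hasNegligibleVariationOutside_of_mcShaneIntegrable hG0 hI₀ hint hprim, fun C _ k => ?_⟩
    refine (restriction_mcShaneIntegrableWithPrimitive_iff (C k)).2
      ⟨hint.to_subbox (Box.le_iff_Icc.2 ((C k).2.trans hI₀)), fun J => hprim (J.incl (C k).2)⟩
  tfae_have 3 → 1 := fun ⟨hD, hN, hR⟩ => by
    have hR' := fun k => (restriction_mcShaneIntegrableWithPrimitive_iff (C k)).1 (hR C hC k)
    exact ⟨fun ε hε => exists_gauge_interior_of_division hD hC hfin (fun k => (hR' k).1)
      (fun k => (hR' k).2) hε, hD, hN⟩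
  tfae_finish
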